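/- Let $A$ be a complex Banach algebra (not necessarily unital) that is Arens regular, i.e. the two Arens products on $A^{**}$ coincide, and let $\varphi$ be a nonzero character on $A$, i.e. a nonzero continuous multiplicative linear functional $A\to\mathbb C$. Let $\mathbb C_\varphi$ be $\mathbb C$ with the $A$-bimodule actions $a\cdot c=\varphi(a)c$ and $c\cdot a=c\,\varphi(a)$, and let $\mathcal B=\mathbb C_\varphi\oplus_1 A$ be the Banach algebra with norm $\|(c,a)\|=|c|+\|a\|$ and product $$(c_1,a_1)(c_2,a_2)=(c_1\cdot a_2+a_1\cdot c_2,\;a_1a_2).$$ Then $\mathcal B^{**}$, with the first Arens product, is a dual Banach algebra with predual $\mathcal B^*$: the canonical image of $\mathcal B^*$ in $\mathcal B^{***}$ is a closed $\mathcal B^{**}$-submodule, and $\mathcal B^{**}$ is canonically and isometrically its dual. Moreover, $\mathcal B^{**}$ is not Connes amenable with respect to this predual: it is not true that, for every Banach $\mathcal B^{**}$-bimodule $E$ whose dual bimodule $E^*$ is normal (for each $x\in E^*$ the maps $b\mapsto b\cdot x$ and $b\mapsto x\cdot b$ from $\mathcal B^{**}$ to $E^*$ are weak*-weak* continuous), every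 weak*-weak* continuous linear map $D:\mathcal B^{**}\to E^*$ with $D(ab)=D(a)\cdot b+a\cdot D(b)$ is inner, i.e. of the form $D(b)=b\cdot x-x\cdot b$ for some $x\in E^*$. -/

import Mathlib

universe u v w

noncomputable section

/-- A Banach `A`-bimodule structure on the normed space `M`: bounded bilinear left and right
actions `a · m` and `m · a` that are associative and commute with each other. -/
structure BanachBimodule (A : Type u) [NonUnitalNormedRing A] [NormedSpace ℂ A]
    (M : Type v) [NormedAddCommGroup M] [NormedSpace ℂ M] where
  /-- `left a m` is `a · m`. -/
  left : A →L[ℂ] M →L[ℂ] M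
  /-- `right a m` is `m · a`. -/
  right : A →L[ℂ] M →L[ℂ] M
  left_mul : ∀ (a b : A) (m : M), left (a * b) m = left a (left b m)
  right_mul : ∀ (a b : A) (m : M), right (a * b) m = right b (right a m)
  left_right : ∀ (a b : A) (m : M), left a (right b m) = right b (left a m)

/-- Both actions are contractive: `‖a · m‖ ≤ ‖a‖ ‖m‖` and `‖m · a‖ ≤ ‖a‖ ‖m‖`. -/
class BanachBimodule.IsContractive {A : Type u} [NonUnitalNormedRing A] [NormedSpace ℂ A]
    {M : Type v} [NormedAddCommGroup M] [NormedSpace ℂ M] (S : BanachBimodule A M) : Prop where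
  norm_left_le : ∀ (a : A) (m : M), ‖S.left a m‖ ≤ ‖a‖ * ‖m‖
  norm_right_le : ∀ (a : A) (m : M), ‖S.right a m‖ ≤ ‖a‖ * ‖m‖

/-! ### The module extension `M ⊕₁ A` -/

section ModuleExtension

variable {A : Type u} [NonUnitalNormedRing A] [NormedSpace ℂ A]
  {M : Type v} [NormedAddCommGroup M] [NormedSpace ℂ M]

/-- The module extension `M ⊕₁ A`, with norm `‖(m, a)‖ = ‖m‖ + ‖a‖`. -/
def ModuleExtension (_S : BanachBimodule A M) : Type (max v u) := WithLp 1 (M × A)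

namespace ModuleExtension

variable (S : BanachBimodule A M)

instance : NormedAddCommGroup (ModuleExtension S) :=
  inferInstanceAs (NormedAddCommGroup (WithLp 1 (M × A)))

instance : NormedSpace ℂ (ModuleExtension S) :=
  inferInstanceAs (NormedSpace ℂ (WithLp 1 (M × A)))

instance [CompleteSpace M] [CompleteSpace A] : CompleteSpace (ModuleExtension S) :=
  inferInstanceAs (CompleteSpace (WithLp 1 (M × A)))

variable {S}

/-- The element `(m, a)` of `M ⊕₁ A`. -/
def mk (m : M) (a : A) : ModuleExtension S := WithLp.toLp 1 (m, a)

/-- The `M`-component. -/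
def fst (x : ModuleExtension S) : M := WithLp.fst (p := 1) (α := M) (β := A) x

/-- The `A`-component. -/
def snd (x : ModuleExtension S) : A := WithLp.snd (p := 1) (α := M) (β := A) x

theorem ext {x y : ModuleExtension S} (h₁ : x.fst = y.fst) (h₂ : x.snd = y.snd) : x = y :=
  WithLp.ofLp_injective 1 (Prod.ext h₁ h₂)

theorem norm_def (x : ModuleExtension S) : ‖x‖ = ‖x.fst‖ + ‖x.snd‖ :=
  WithLp.prod_norm_eq_of_L1 (α := M) (β := A) x

/-- The product `(m₁, a₁) (m₂, a₂) = (m₁ · a₂ + a₁ · m₂, a₁ a₂)`. -/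
instance : Mul (ModuleExtension S) :=
  ⟨fun x y => mk (S.right y.snd x.fst + S.left x.snd y.fst) (x.snd * y.snd)⟩

@[simp] theorem fst_mk (m : M) (a : A) : (mk m a : ModuleExtension S).fst = m := rfl
@[simp] theorem snd_mk (m : M) (a : A) : (mk m a : ModuleExtension S).snd = a := rfl
@[simp] theorem fst_add (x y : ModuleExtension S) : (x + y).fst = x.fst + y.fst := rfl
@[simp] theorem snd_add (x y : ModuleExtension S) : (x + y).snd = x.snd + y.snd := rfl
@[simp] theorem fst_zero : (0 : ModuleExtension S).fst = 0 := rfl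
@[simp] theorem snd_zero : (0 : ModuleExtension S).snd = 0 := rfl
@[simp] theorem fst_smul (c : ℂ) (x : ModuleExtension S) : (c • x).fst = c • x.fst := rfl
@[simp] theorem snd_smul (c : ℂ) (x : ModuleExtension S) : (c • x).snd = c • x.snd := rfl
@[simp] theorem fst_mul (x y : ModuleExtension S) :
    (x * y).fst = S.right y.snd x.fst + S.left x.snd y.fst := rfl
@[simp] theorem snd_mul (x y : ModuleExtension S) : (x * y).snd = x.snd * y.snd := rfl

instance : NonUnitalRing (ModuleExtension S) :=
  { (inferInstance : AddCommGroup (ModuleExtension S)),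
    (inferInstance : Mul (ModuleExtension S)) with
    left_distrib := fun x y z => ext
      (by simp only [fst_mul, fst_add, snd_add, map_add, add_apply]; abel)
      (by simp [mul_add])
    right_distrib := fun x y z => ext
      (by simp only [fst_mul, fst_add, snd_add, map_add, add_apply]; abel)
      (by simp [add_mul])
    zero_mul := fun x => ext (by simp) (by simp)
    mul_zero := fun x => ext (by simp) (by simp)
    mul_assoc := fun x y z => ext
      (by simp only [fst_mul, snd_mul, map_add, S.left_mul, S.right_mul, S.left_right]; abel)
      (by simp [mul_assoc]) }

instance [S.IsContractive] : NonUnitalNormedRing (ModuleExtension S) :=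
  { (inferInstance : NormedAddCommGroup (ModuleExtension S)),
    (inferInstance : NonUnitalRing (ModuleExtension S)) with
    norm_mul_le := fun x y => by
      change ‖x * y‖ ≤ ‖x‖ * ‖y‖
      rw [norm_def, norm_def x, norm_def y, fst_mul, snd_mul]
      have h₁ := norm_add_le (S.right y.snd x.fst) (S.left x.snd y.fst)
      have h₂ := BanachBimodule.IsContractive.norm_right_le (S := S) y.snd x.fst
      have h₃ := BanachBimodule.IsContractive.norm_left_le (S := S) x.snd y.fst
      have h₄ := norm_mul_le x.snd y.snd
      have h₅ := mul_nonneg (norm_nonneg x.fst) (norm_nonneg y.fst)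
      nlinarith }

instance [S.IsContractive] [IsScalarTower ℂ A A] :
    IsScalarTower ℂ (ModuleExtension S) (ModuleExtension S) :=
  ⟨fun c x y => ext (by simp [smul_eq_mul]) (by simp [smul_eq_mul, smul_mul_assoc])⟩

instance [S.IsContractive] [SMulCommClass ℂ A A] :
    SMulCommClass ℂ (ModuleExtension S) (ModuleExtension S) :=
  ⟨fun c x y => ext (by simp [smul_eq_mul]) (by simp [smul_eq_mul, mul_smul_comm])⟩

end ModuleExtension

end ModuleExtension

/-! ### The bimodule `ℂ_φ` of a character `φ` -/

section CharacterModule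

variable {A : Type u} [NonUnitalNormedRing A] [NormedSpace ℂ A]

/-- `ℂ` as an `A`-bimodule with `a · c = φ(a) c` and `c · a = c φ(a)`. -/
def characterModule (φ : WeakDual.characterSpace ℂ A) : BanachBimodule A ℂ where
  left := (ContinuousLinearMap.mul ℂ ℂ).comp (WeakDual.toStrongDual (φ : WeakDual ℂ A))
  right := (ContinuousLinearMap.mul ℂ ℂ).flip.comp (WeakDual.toStrongDual (φ : WeakDual ℂ A))
  left_mul a b c := by
    change φ (a * b) * c = φ a * (φ b * c)
    rw [map_mul, mul_assoc]
  right_mul a b c := by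
    change c * φ (a * b) = c * φ a * φ b
    rw [map_mul, mul_assoc]
  left_right a b c := by
    change φ a * (c * φ b) = φ a * c * φ b
    rw [mul_assoc]

@[simp] theorem characterModule_left (φ : WeakDual.characterSpace ℂ A) (a : A) (c : ℂ) :
    (characterModule φ).left a c = φ a * c := rfl

@[simp] theorem characterModule_right (φ : WeakDual.characterSpace ℂ A) (a : A) (c : ℂ) :
    (characterModule φ).right a c = c * φ a := rfl

/-- Characters are contractive. -/
theorem character_norm_le (φ : WeakDual.characterSpace ℂ A) (a : A) : ‖φ a‖ ≤ ‖a‖ := by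
  set f : StrongDual ℂ A := WeakDual.toStrongDual (φ : WeakDual ℂ A) with hf
  have hfφ : ∀ b, f b = φ b := fun b => rfl
  -- boundedness by `‖f‖`, applied to the powers of `a`
  have key : ∀ n : ℕ, ∃ b : A, ‖b‖ ≤ ‖a‖ ^ (n + 1) ∧ φ b = φ a ^ (n + 1) := by
    intro n
    induction n with
    | zero => exact ⟨a, by simp, by simp⟩
    | succ n ih =>
      obtain ⟨b, hb, hb'⟩ := ih
      refine ⟨b * a, ?_, ?_⟩
      · calc ‖b * a‖ ≤ ‖b‖ * ‖a‖ := norm_mul_le _ _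
          _ ≤ ‖a‖ ^ (n + 1) * ‖a‖ := by gcongr
          _ = ‖a‖ ^ (n + 1 + 1) := (pow_succ _ _).symm
      · rw [map_mul, hb', ← pow_succ]
  by_contra! hlt
  have hpos : 0 < ‖φ a‖ := lt_of_le_of_lt (norm_nonneg a) hlt
  have hr : ‖a‖ / ‖φ a‖ < 1 := (div_lt_one hpos).2 hlt
  have hr0 : 0 ≤ ‖a‖ / ‖φ a‖ := by positivity
  have hle : ∀ n : ℕ, 1 ≤ ‖f‖ * (‖a‖ / ‖φ a‖) ^ (n + 1) := by
    intro n
    obtain ⟨b, hb, hb'⟩ := key n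
    have h1 : ‖φ a‖ ^ (n + 1) ≤ ‖f‖ * ‖a‖ ^ (n + 1) := by
      rw [← norm_pow, ← hb', ← hfφ]
      exact (f.le_opNorm b).trans (by gcongr)
    rw [div_pow, mul_div_assoc', le_div_iff₀ (by positivity), one_mul]
    exact h1
  have hlim : Filter.Tendsto (fun n : ℕ => ‖f‖ * (‖a‖ / ‖φ a‖) ^ (n + 1)) Filter.atTop
      (nhds (‖f‖ * 0)) :=
    ((tendsto_pow_atTop_nhds_zero_of_lt_one hr0 hr).comp
      (Filter.tendsto_add_atTop_nat 1)).const_mul _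
  have := ge_of_tendsto' hlim hle
  norm_num at this

instance (φ : WeakDual.characterSpace ℂ A) : (characterModule φ).IsContractive where
  norm_left_le a c := by
    rw [characterModule_left, norm_mul]
    exact mul_le_mul_of_nonneg_right (character_norm_le φ a) (norm_nonneg c)
  norm_right_le a c := by
    rw [characterModule_right, norm_mul, mul_comm]
    exact mul_le_mul_of_nonneg_right (character_norm_le φ a) (norm_nonneg c)

end CharacterModule

/-! ### Arens products on the second dual -/

section Arens

variable {A : Type u} [NonUnitalNormedRing A] [NormedSpace ℂ A] [IsScalarTower ℂ A A]
  [SMulCommClass ℂ A A]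

/-- The functional `a · f ∈ A*`, given by `(a · f)(b) = f (b a)`. -/
def dualLeft (a : A) (f : StrongDual ℂ A) : StrongDual ℂ A :=
  f.comp ((ContinuousLinearMap.mul ℂ A).flip a)

/-- The functional `f · a ∈ A*`, given by `(f · a)(b) = f (a b)`. -/
def dualRight (f : StrongDual ℂ A) (a : A) : StrongDual ℂ A :=
  f.comp (ContinuousLinearMap.mul ℂ A a)

@[simp] theorem dualLeft_apply (a : A) (f : StrongDual ℂ A) (b : A) :
    dualLeft a f b = f (b * a) := rfl

@[simp] theorem dualRight_apply (f : StrongDual ℂ A) (a b : A) :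
    dualRight f a b = f (a * b) := rfl

theorem norm_dualLeft_le (a : A) (f : StrongDual ℂ A) : ‖dualLeft a f‖ ≤ ‖f‖ * ‖a‖ :=
  ContinuousLinearMap.opNorm_le_bound _ (by positivity) fun b => by
    calc ‖f (b * a)‖ ≤ ‖f‖ * ‖b * a‖ := f.le_opNorm _
      _ ≤ ‖f‖ * (‖b‖ * ‖a‖) := by gcongr; exact norm_mul_le _ _
      _ = ‖f‖ * ‖a‖ * ‖b‖ := by ring

theorem norm_dualRight_le (f : StrongDual ℂ A) (a : A) : ‖dualRight f a‖ ≤ ‖f‖ * ‖a‖ :=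
  ContinuousLinearMap.opNorm_le_bound _ (by positivity) fun b => by
    calc ‖f (a * b)‖ ≤ ‖f‖ * ‖a * b‖ := f.le_opNorm _
      _ ≤ ‖f‖ * (‖a‖ * ‖b‖) := by gcongr; exact norm_mul_le _ _
      _ = ‖f‖ * ‖a‖ * ‖b‖ := by ring

/-- For `n ∈ A**`, the bounded operator `f ↦ n · f` on `A*`, where `(n · f)(a) = n (f · a)`. -/
def bidualLeft (n : StrongDual ℂ (StrongDual ℂ A)) : StrongDual ℂ A →L[ℂ] StrongDual ℂ A :=
  LinearMap.mkContinuous₂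
    (LinearMap.mk₂ ℂ (fun (f : StrongDual ℂ A) (a : A) => n (dualRight f a))
      (fun f g a => by rw [← map_add]; congr 1)
      (fun c f a => by rw [← map_smul]; congr 1)
      (fun f a b => by rw [← map_add]; congr 1; ext x; simp [add_mul])
      (fun c f a => by rw [← map_smul]; congr 1; ext x; simp [smul_mul_assoc]))
    ‖n‖ (fun f a => by
      refine (n.le_opNorm _).trans ?_
      rw [mul_assoc]
      exact mul_le_mul_of_nonneg_left (norm_dualRight_le f a) (norm_nonneg n))

/-- For `m ∈ A**`, the bounded operator `f ↦ f · m` on `A*`, where `(f · m)(a) = m (a · f)`. -/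
def bidualRight (m : StrongDual ℂ (StrongDual ℂ A)) : StrongDual ℂ A →L[ℂ] StrongDual ℂ A :=
  LinearMap.mkContinuous₂
    (LinearMap.mk₂ ℂ (fun (f : StrongDual ℂ A) (a : A) => m (dualLeft a f))
      (fun f g a => by rw [← map_add]; congr 1)
      (fun c f a => by rw [← map_smul]; congr 1)
      (fun f a b => by rw [← map_add]; congr 1; ext x; simp [mul_add])
      (fun c f a => by rw [← map_smul]; congr 1; ext x; simp [mul_smul_comm]))
    ‖m‖ (fun f a => by
      refine (m.le_opNorm _).trans ?_
      rw [mul_assoc]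
      exact mul_le_mul_of_nonneg_left (norm_dualLeft_le a f) (norm_nonneg m))

@[simp] theorem bidualLeft_apply (n : StrongDual ℂ (StrongDual ℂ A)) (f : StrongDual ℂ A)
    (a : A) : bidualLeft n f a = n (dualRight f a) := rfl

@[simp] theorem bidualRight_apply (m : StrongDual ℂ (StrongDual ℂ A)) (f : StrongDual ℂ A)
    (a : A) : bidualRight m f a = m (dualLeft a f) := rfl

theorem norm_bidualLeft_le (n : StrongDual ℂ (StrongDual ℂ A)) : ‖bidualLeft n‖ ≤ ‖n‖ :=
  LinearMap.mkContinuous₂_norm_le _ (norm_nonneg n) _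

/-- The first Arens product `m □ n`: `(m □ n)(f) = m (n · f)`. -/
def firstArens (m n : StrongDual ℂ (StrongDual ℂ A)) : StrongDual ℂ (StrongDual ℂ A) :=
  m.comp (bidualLeft n)

/-- The second Arens product `m ◇ n`: `(m ◇ n)(f) = n (f · m)`. -/
def secondArens (m n : StrongDual ℂ (StrongDual ℂ A)) : StrongDual ℂ (StrongDual ℂ A) :=
  n.comp (bidualRight m)

@[simp] theorem firstArens_apply (m n : StrongDual ℂ (StrongDual ℂ A)) (f : StrongDual ℂ A) :
    firstArens m n f = m (bidualLeft n f) := rfl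

@[simp] theorem secondArens_apply (m n : StrongDual ℂ (StrongDual ℂ A)) (f : StrongDual ℂ A) :
    secondArens m n f = n (bidualRight m f) := rfl

end Arens

/-- `A` is Arens regular: the two Arens products on `A**` coincide. -/
def IsArensRegular (A : Type u) [NonUnitalNormedRing A] [NormedSpace ℂ A] [IsScalarTower ℂ A A]
    [SMulCommClass ℂ A A] : Prop :=
  ∀ m n : StrongDual ℂ (StrongDual ℂ A), firstArens m n = secondArens m n

/-- The second dual `A**`, regarded below as a Banach algebra under the first Arens product. -/
def SecondDual (A : Type u) [NonUnitalNormedRing A] [NormedSpace ℂ A] : Type u :=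
  StrongDual ℂ (StrongDual ℂ A)

namespace SecondDual

variable (A : Type u) [NonUnitalNormedRing A] [NormedSpace ℂ A]

instance : NormedAddCommGroup (SecondDual A) :=
  inferInstanceAs (NormedAddCommGroup (StrongDual ℂ (StrongDual ℂ A)))

instance : NormedSpace ℂ (SecondDual A) :=
  inferInstanceAs (NormedSpace ℂ (StrongDual ℂ (StrongDual ℂ A)))

instance : CompleteSpace (SecondDual A) :=
  inferInstanceAs (CompleteSpace (StrongDual ℂ (StrongDual ℂ A)))

variable [IsScalarTower ℂ A A] [SMulCommClass ℂ A A]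

instance : Mul (SecondDual A) := ⟨fun m n => firstArens (A := A) m n⟩

instance : NonUnitalNormedRing (SecondDual A) :=
  { (inferInstance : NormedAddCommGroup (SecondDual A)),
    (inferInstance : Mul (SecondDual A)) with
    left_distrib := fun m n k => by
      refine ContinuousLinearMap.ext fun f => ?_
      change StrongDual ℂ (StrongDual ℂ A) at m n k
      change m (bidualLeft (n + k) f) = m (bidualLeft n f) + m (bidualLeft k f)
      rw [← map_add]
      rfl
    right_distrib := fun m n k => rfl
    zero_mul := fun m => rfl
    mul_zero := fun m => by
      refine ContinuousLinearMap.ext fun f => ?_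
      change StrongDual ℂ (StrongDual ℂ A) at m
      change m (bidualLeft 0 f) = 0
      have : bidualLeft (0 : StrongDual ℂ (StrongDual ℂ A)) f = 0 := rfl
      rw [this, map_zero]
    mul_assoc := fun m n k => by
      refine ContinuousLinearMap.ext fun f => ?_
      change StrongDual ℂ (StrongDual ℂ A) at m n k
      change m (bidualLeft n (bidualLeft k f)) = m (bidualLeft (firstArens n k) f)
      congr 1
      refine ContinuousLinearMap.ext fun a => ?_
      change n (dualRight (bidualLeft k f) a) = n (bidualLeft k (dualRight f a))
      congr 1
      refine ContinuousLinearMap.ext fun b => ?_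
      change k (dualRight f (a * b)) = k (dualRight (dualRight f a) b)
      congr 1
      refine ContinuousLinearMap.ext fun c => ?_
      change f (a * b * c) = f (a * (b * c))
      rw [mul_assoc]
    norm_mul_le := fun m n => by
      change StrongDual ℂ (StrongDual ℂ A) at m n
      change ‖m.comp (bidualLeft n)‖ ≤ ‖m‖ * ‖n‖
      exact (ContinuousLinearMap.opNorm_comp_le _ _).trans
        (mul_le_mul_of_nonneg_left (norm_bidualLeft_le n) (norm_nonneg m)) }

theorem mul_def (m n : SecondDual A) : m * n = firstArens (A := A) m n := rfl

instance : IsScalarTower ℂ (SecondDual A) (SecondDual A) := ⟨fun _ _ _ => rfl⟩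

instance : SMulCommClass ℂ (SecondDual A) (SecondDual A) := ⟨fun c m n => by
  refine ContinuousLinearMap.ext fun f => ?_
  change StrongDual ℂ (StrongDual ℂ A) at m n
  change c • m (bidualLeft n f) = m (bidualLeft (c • n) f)
  rw [← map_smul]
  rfl⟩

/-- The canonical image of `A*` in `A***`. -/
def predual : Submodule ℂ (StrongDual ℂ (SecondDual A)) :=
  LinearMap.range (NormedSpace.inclusionInDoubleDual ℂ (StrongDual ℂ A)).toLinearMap

end SecondDual

/-! ### Dual Banach algebras and Connes amenability -/

section DualBanachAlgebra

variable {B : Type u} [NonUnitalNormedRing B] [NormedSpace ℂ B]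

/-- The subspace `P` of `B*`, regarded as a normed space with the norm of `B*`. -/
def PredualSpace (P : Submodule ℂ (StrongDual ℂ B)) : Type u := P

instance (P : Submodule ℂ (StrongDual ℂ B)) : NormedAddCommGroup (PredualSpace P) :=
  inferInstanceAs (NormedAddCommGroup P)

instance (P : Submodule ℂ (StrongDual ℂ B)) : NormedSpace ℂ (PredualSpace P) :=
  inferInstanceAs (NormedSpace ℂ P)

/-- The canonical map `B → P*`, `b ↦ (f ↦ f b)`, for a subspace `P` of `B*`. -/
def evalOn (P : Submodule ℂ (StrongDual ℂ B)) (b : B) : StrongDual ℂ (PredualSpace P) :=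
  LinearMap.mkContinuous
    { toFun := fun f : PredualSpace P => (f.1 : StrongDual ℂ B) b
      map_add' := fun _ _ => rfl
      map_smul' := fun _ _ => rfl }
    ‖b‖ (fun f => by
      rw [mul_comm]
      exact (f.1 : StrongDual ℂ B).le_opNorm b)

@[simp] theorem evalOn_apply (P : Submodule ℂ (StrongDual ℂ B)) (b : B) (f : PredualSpace P) :
    evalOn P b f = (f.1 : StrongDual ℂ B) b := rfl

/-- `B` is a dual Banach algebra with predual `P`: `B` is complete, `P` is a closed `B`-submodule
of `B*`, and canonically `B = P*` isometrically. -/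
structure IsDualBanachAlgebra [IsScalarTower ℂ B B] [SMulCommClass ℂ B B]
    (P : Submodule ℂ (StrongDual ℂ B)) : Prop where
  complete : CompleteSpace B
  closed : IsClosed (P : Set (StrongDual ℂ B))
  left_mem : ∀ (b : B), ∀ f ∈ P, dualLeft b f ∈ P
  right_mem : ∀ (b : B), ∀ f ∈ P, dualRight f b ∈ P
  norm_evalOn : ∀ b : B, ‖evalOn P b‖ = ‖b‖
  surjective_evalOn : Function.Surjective (evalOn P)

/-- The weak* topology on `B` given by the predual `P`: the coarsest one making every functional
in `P` continuous. -/
@[reducible] def weakStarTopology (P : Submodule ℂ (StrongDual ℂ B)) : TopologicalSpace B :=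
  ⨅ f : P, TopologicalSpace.induced (fun b : B => (f : StrongDual ℂ B) b) inferInstance

/-- Continuity of a map `T : B → E*` from the weak* topology of `B` (given by `P`) to the weak*
topology of `E*`. -/
def WeakStarContinuous {E : Type w} [NormedAddCommGroup E] [NormedSpace ℂ E]
    (P : Submodule ℂ (StrongDual ℂ B)) (T : B → StrongDual ℂ E) : Prop :=
  @Continuous B (WeakDual ℂ E) (weakStarTopology P) inferInstance
    (fun b => StrongDual.toWeakDual (T b))

variable {E : Type w} [NormedAddCommGroup E] [NormedSpace ℂ E]

/-- The dual left action on `E*`: `(b · x)(e) = x (e · b)`. -/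
def BanachBimodule.dualLeftAction (S : BanachBimodule B E) (b : B) (x : StrongDual ℂ E) :
    StrongDual ℂ E := x.comp (S.right b)

/-- The dual right action on `E*`: `(x · b)(e) = x (b · e)`. -/
def BanachBimodule.dualRightAction (S : BanachBimodule B E) (x : StrongDual ℂ E) (b : B) :
    StrongDual ℂ E := x.comp (S.left b)

/-- The dual bimodule `E*` is normal: for each `x ∈ E*` the maps `b ↦ b · x` and `b ↦ x · b` are
weak*-weak* continuous. -/
def BanachBimodule.IsNormalDual (S : BanachBimodule B E) (P : Submodule ℂ (StrongDual ℂ B)) :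
    Prop :=
  ∀ x : StrongDual ℂ E, WeakStarContinuous P (fun b => S.dualLeftAction b x) ∧
    WeakStarContinuous P (fun b => S.dualRightAction x b)

/-- `D : B → E*` is a derivation: `D(ab) = D(a) · b + a · D(b)`. -/
def BanachBimodule.IsDerivation (S : BanachBimodule B E) (D : B →ₗ[ℂ] StrongDual ℂ E) : Prop :=
  ∀ a b : B, D (a * b) = S.dualRightAction (D a) b + S.dualLeftAction a (D b)

/-- `D : B → E*` is inner: `D(b) = b · x - x · b` for some `x ∈ E*`. -/
def BanachBimodule.IsInner (S : BanachBimodule B E) (D : B →ₗ[ℂ] StrongDual ℂ E) : Prop :=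
  ∃ x : StrongDual ℂ E, ∀ b : B, D b = S.dualLeftAction b x - S.dualRightAction x b

end DualBanachAlgebra

/-- Connes amenability of `B` with respect to the predual `P`: every weak*-weak* continuous
derivation into a normal dual Banach `B`-bimodule `E*` is inner. -/
def IsConnesAmenable {B : Type u} [NonUnitalNormedRing B] [NormedSpace ℂ B]
    (P : Submodule ℂ (StrongDual ℂ B)) : Prop :=
  ∀ (E : Type w) [NormedAddCommGroup E] [NormedSpace ℂ E] [CompleteSpace E]
    (S : BanachBimodule B E), S.IsNormalDual P →
    ∀ D : B →ₗ[ℂ] StrongDual ℂ E, S.IsDerivation D → WeakStarContinuous P D → S.IsInner D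

end

/-! Write `Φ` and `d` for the functionals on `ℬ**` given by evaluation at `(c, a) ↦ φ a` and at `(c,
a) ↦ c`, two elements of `ℬ*`. Since `φ` gives both actions on `ℂ_φ`, the first coordinate is a
point derivation of `ℬ` at `φ`. This survives in the second dual: `Φ` is multiplicative, `d(mn) =
Φ(n) d(m) + Φ(m) d(n)`, and `d ≠ 0`. Both lie in the predual, so `ℂ` with both actions through `Φ`
has a normal dual, and `d` is a weak*-continuous derivation into it. The two actions agree, so every
inner derivation there is zero and `d` is not inner (`not_isConnesAmenable_of_pointDerivation`).

For the dual Banach algebra structure, regularity of `ℬ` is what makes the predual a submodule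
(`IsArensRegular.isDualBanachAlgebra`). It is inherited from `A` because `ℬ*` is `ℂ ⊕ A*`: on `A*`
the Arens products are those of `A`, and on the first coordinate both equal the symmetric formula
for `d` (`isArensRegular_characterModule`). -/

/-! ### Point derivations and Connes amenability -/

section ConnesAmenability

variable {B : Type u} [NonUnitalNormedRing B] [NormedSpace ℂ B]

/-- The one-dimensional bimodule on which both actions of `b` are multiplication by `Φ b`. -/
noncomputable def scalarBimodule (Φ : StrongDual ℂ B) (hΦ : ∀ a b, Φ (a * b) = Φ a * Φ b) :
    BanachBimodule B (ULift.{w} ℂ) where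
  left := (ContinuousLinearMap.lsmul ℂ ℂ).comp Φ
  right := (ContinuousLinearMap.lsmul ℂ ℂ).comp Φ
  left_mul a b m := by
    change Φ (a * b) • m = Φ a • Φ b • m
    rw [hΦ, mul_smul]
  right_mul a b m := by
    change Φ (a * b) • m = Φ b • Φ a • m
    rw [hΦ, mul_comm, mul_smul]
  left_right a b m := by
    change Φ a • Φ b • m = Φ b • Φ a • m
    rw [← mul_smul, mul_comm, mul_smul]

theorem scalarBimodule_dualLeftAction (Φ : StrongDual ℂ B) (hΦ : ∀ a b, Φ (a * b) = Φ a * Φ b)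
    (b : B) (x : StrongDual ℂ (ULift.{w} ℂ)) :
    (scalarBimodule Φ hΦ).dualLeftAction b x = Φ b • x :=
  ContinuousLinearMap.ext fun e => map_smul x (Φ b) e

theorem scalarBimodule_dualRightAction (Φ : StrongDual ℂ B) (hΦ : ∀ a b, Φ (a * b) = Φ a * Φ b)
    (b : B) (x : StrongDual ℂ (ULift.{w} ℂ)) :
    (scalarBimodule Φ hΦ).dualRightAction x b = Φ b • x :=
  ContinuousLinearMap.ext fun e => map_smul x (Φ b) e

/-- Only the scalar `f b` varies with `b`, and `f` is one of the functionals defining the topology.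
This serves both for normality of the bimodule and for continuity of the derivation. -/
theorem weakStarContinuous_smul {P : Submodule ℂ (StrongDual ℂ B)} {f : StrongDual ℂ B}
    (hf : f ∈ P) {E : Type w} [NormedAddCommGroup E] [NormedSpace ℂ E] (x : StrongDual ℂ E) :
    WeakStarContinuous P (fun b => f b • x) := by
  have hfc : @Continuous B ℂ (weakStarTopology P) inferInstance (fun b => f b) :=
    continuous_iInf_dom (i := (⟨f, hf⟩ : P)) continuous_induced_dom
  unfold WeakStarContinuous
  let _ : TopologicalSpace B := weakStarTopology P
  exact WeakDual.continuous_of_continuous_eval fun e => hfc.mul continuous_const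

/-- A nonzero weak*-continuous point derivation at a weak*-continuous multiplicative functional
obstructs Connes amenability. -/
theorem not_isConnesAmenable_of_pointDerivation {P : Submodule ℂ (StrongDual ℂ B)}
    {Φ d : StrongDual ℂ B} (hΦP : Φ ∈ P) (hdP : d ∈ P) (hΦ : ∀ a b, Φ (a * b) = Φ a * Φ b)
    (hd : ∀ a b, d (a * b) = Φ b * d a + Φ a * d b) (hd0 : d ≠ 0) :
    ¬ IsConnesAmenable.{u, w} P := by
  intro h
  -- The identity functional of `ℂ`; `ULift` only moves `ℂ` to the universe of the test modules.
  let x₀ : StrongDual ℂ (ULift.{w} ℂ) :=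
    (ContinuousLinearEquiv.ulift (R₁ := ℂ) (M₁ := ℂ)).toContinuousLinearMap
  obtain ⟨x, hx⟩ := h (ULift.{w} ℂ) (scalarBimodule Φ hΦ)
    (fun x => ⟨by simpa only [scalarBimodule_dualLeftAction] using weakStarContinuous_smul hΦP x,
      by simpa only [scalarBimodule_dualRightAction] using weakStarContinuous_smul hΦP x⟩)
    (d.toLinearMap.smulRight x₀)
    (fun a b => by
      rw [scalarBimodule_dualLeftAction, scalarBimodule_dualRightAction]
      change d (a * b) • x₀ = Φ b • d a • x₀ + Φ a • d b • x₀
      rw [hd]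
      ext e
      change (Φ b * d a + Φ a * d b) * x₀ e = Φ b * (d a * x₀ e) + Φ a * (d b * x₀ e)
      ring)
    (weakStarContinuous_smul hdP x₀)
  refine hd0 (ContinuousLinearMap.ext fun b => ?_)
  have hb := hx b
  -- Both actions of `b` on `x` are `Φ b • x`, so the inner derivation cancels.
  rw [scalarBimodule_dualLeftAction, scalarBimodule_dualRightAction, sub_self] at hb
  have h1 : d b * 1 = 0 := DFunLike.congr_fun hb (ULift.up 1)
  simpa using h1

end ConnesAmenability

/-! ### Second duals of Arens regular algebras -/

section ArensRegular

variable {A : Type u} [NonUnitalNormedRing A] [NormedSpace ℂ A]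

variable [IsScalarTower ℂ A A] [SMulCommClass ℂ A A]

theorem SecondDual.mem_predual (f : StrongDual ℂ A) :
    NormedSpace.inclusionInDoubleDual ℂ (StrongDual ℂ A) f ∈ SecondDual.predual A :=
  ⟨f, rfl⟩

/-- The second dual of an Arens regular Banach algebra is a dual Banach algebra. -/
theorem IsArensRegular.isDualBanachAlgebra (hA : IsArensRegular A) :
    IsDualBanachAlgebra (SecondDual.predual A) where
  complete := inferInstance
  closed := by
    have h := (NormedSpace.inclusionInDoubleDualLi ℂ (E := StrongDual ℂ A)).isometry
    exact (h.isUniformInducing.isComplete_range).isClosed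
  left_mem := by
    rintro b _ ⟨g, rfl⟩
    -- Holds by definition of the first product: `(n □ b)(g) = n (b · g)`.
    exact ⟨bidualLeft b g, rfl⟩
  right_mem := by
    rintro b _ ⟨g, rfl⟩
    -- Regularity enters here: `(b □ n)(g) = (b ◇ n)(g) = n (g · b)`, which is evaluation of `n` at
    -- an element of `A*`.
    refine ⟨bidualRight b g, ContinuousLinearMap.ext fun n => ?_⟩
    exact (DFunLike.congr_fun (hA b n) g).symm
  norm_evalOn b := by
    refine le_antisymm (LinearMap.mkContinuous_norm_le _ (norm_nonneg b) _) ?_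
    refine ContinuousLinearMap.opNorm_le_bound (E := StrongDual ℂ A) (F := ℂ) b
      (norm_nonneg _) fun g => ?_
    -- The embedding of `A*` is isometric, so testing on the predual already recovers the norm of
    -- `b` on `A*`.
    have h := (evalOn (SecondDual.predual A) b).le_opNorm ⟨_, SecondDual.mem_predual g⟩
    refine h.trans_eq ?_
    congr 1
    exact (NormedSpace.inclusionInDoubleDualLi ℂ (E := StrongDual ℂ A)).norm_map g
  surjective_evalOn T := by
    let J : StrongDual ℂ A →L[ℂ] PredualSpace (SecondDual.predual A) :=
      (NormedSpace.inclusionInDoubleDual ℂ (StrongDual ℂ A)).codRestrict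
        (SecondDual.predual A) SecondDual.mem_predual
    -- A functional on the predual becomes an element of `A**` by restriction along `A* → predual`.
    refine ⟨T.comp J, ContinuousLinearMap.ext ?_⟩
    rintro ⟨_, g, rfl⟩
    rfl

end ArensRegular

/-! ### Arens products on the module extension -/

namespace ModuleExtension

variable {A : Type u} [NonUnitalNormedRing A] [NormedSpace ℂ A]

section

variable {M : Type v} [NormedAddCommGroup M] [NormedSpace ℂ M] (S : BanachBimodule A M)

/-- The projection `M ⊕₁ A → M`. -/
noncomputable def fstL : ModuleExtension S →L[ℂ] M :=
  LinearMap.mkContinuous { toFun := fst, map_add' := fst_add, map_smul' := fst_smul } 1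
    fun x => by rw [one_mul, norm_def]; exact le_add_of_nonneg_right (norm_nonneg _)

/-- The projection `M ⊕₁ A → A`. -/
noncomputable def sndL : ModuleExtension S →L[ℂ] A :=
  LinearMap.mkContinuous { toFun := snd, map_add' := snd_add, map_smul' := snd_smul } 1
    fun x => by rw [one_mul, norm_def]; exact le_add_of_nonneg_left (norm_nonneg _)

/-- The embedding `A → M ⊕₁ A`. -/
noncomputable def inrL : A →L[ℂ] ModuleExtension S :=
  LinearMap.mkContinuous
    { toFun := mk 0
      map_add' := fun _ _ => ext (by simp) (by simp)
      map_smul' := fun _ _ => ext (by simp) (by simp) } 1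
    fun a => by rw [one_mul]; exact (norm_def _).trans_le (by simp)

@[simp] theorem fstL_apply (x : ModuleExtension S) : fstL S x = x.fst := rfl
@[simp] theorem sndL_apply (x : ModuleExtension S) : sndL S x = x.snd := rfl
@[simp] theorem inrL_apply (a : A) : inrL S a = mk 0 a := rfl

/-- Pulling functionals back along the projection `M ⊕₁ A → A`. -/
noncomputable def pullback : StrongDual ℂ A →L[ℂ] StrongDual ℂ (ModuleExtension S) :=
  (ContinuousLinearMap.compL ℂ (ModuleExtension S) A ℂ).flip (sndL S)

@[simp] theorem pullback_apply (h : StrongDual ℂ A) (x : ModuleExtension S) :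
    pullback S h x = h x.snd := rfl

variable [S.IsContractive] [IsScalarTower ℂ A A] [SMulCommClass ℂ A A]

/-- The projection to `A` is multiplicative, so its transpose intertwines the actions; `n.comp
(pullback S)` is the image of `n` in `A**`. -/
theorem bidualLeft_pullback (n : StrongDual ℂ (StrongDual ℂ (ModuleExtension S)))
    (h : StrongDual ℂ A) :
    bidualLeft n (pullback S h) = pullback S (bidualLeft (n.comp (pullback S)) h) :=
  rfl

theorem bidualRight_pullback (m : StrongDual ℂ (StrongDual ℂ (ModuleExtension S)))
    (h : StrongDual ℂ A) :
    bidualRight m (pullback S h) = pullback S (bidualRight (m.comp (pullback S)) h) :=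
  rfl

end

variable (φ : WeakDual.characterSpace ℂ A)

/-- The functional `(c, a) ↦ φ a` on `ℂ_φ ⊕₁ A`. -/
noncomputable def liftCharacter : StrongDual ℂ (ModuleExtension (characterModule φ)) :=
  pullback (characterModule φ) (WeakDual.toStrongDual (φ : WeakDual ℂ A))

@[simp] theorem liftCharacter_apply (x : ModuleExtension (characterModule φ)) :
    liftCharacter φ x = φ x.snd := rfl

/-- The splitting `ℬ* = ℂ ⊕ A*`, which lets regularity be tested on each summand. -/
theorem functional_decomposition (g : StrongDual ℂ (ModuleExtension (characterModule φ))) :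
    g = g (mk 1 0) • fstL (characterModule φ) +
      pullback (characterModule φ) (g.comp (inrL (characterModule φ))) := by
  ext x
  have hx : x = x.fst • mk 1 0 + mk 0 x.snd := ext (by simp) (by simp)
  conv_lhs => rw [hx, map_add, map_smul]
  simp [mul_comm]

variable [IsScalarTower ℂ A A] [SMulCommClass ℂ A A]

/-- Multiplicativity of `φ` makes the lifted character an eigenvector of every `bidualLeft n`,
whence `Φ` is multiplicative on `ℬ**`. -/
theorem bidualLeft_liftCharacter
    (n : StrongDual ℂ (StrongDual ℂ (ModuleExtension (characterModule φ)))) :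
    bidualLeft n (liftCharacter φ) = n (liftCharacter φ) • liftCharacter φ := by
  ext x
  have h : dualRight (liftCharacter φ) x = liftCharacter φ x • liftCharacter φ := by
    ext y; simp
  rw [bidualLeft_apply, h, map_smul]
  exact mul_comm _ _

/-- The point derivation identity for the first coordinate, with one factor replaced by an element
of `ℬ**`. Applying `m` yields the Leibniz rule for `d`. -/
theorem bidualLeft_fstL
    (n : StrongDual ℂ (StrongDual ℂ (ModuleExtension (characterModule φ)))) :
    bidualLeft n (fstL (characterModule φ)) =
      n (liftCharacter φ) • fstL (characterModule φ) +
        n (fstL (characterModule φ)) • liftCharacter φ := by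
  ext x
  have h : dualRight (fstL (characterModule φ)) x =
      x.fst • liftCharacter φ + φ x.snd • fstL (characterModule φ) := by
    ext y; simp
  rw [bidualLeft_apply, h, map_add, map_smul, map_smul]
  simp [mul_comm]

/-- Same formula as for `bidualLeft`, because the first coordinate of `xy` is symmetric in `x` and
`y`. -/
theorem bidualRight_fstL
    (m : StrongDual ℂ (StrongDual ℂ (ModuleExtension (characterModule φ)))) :
    bidualRight m (fstL (characterModule φ)) =
      m (liftCharacter φ) • fstL (characterModule φ) +
        m (fstL (characterModule φ)) • liftCharacter φ := by
  ext x
  have h : dualLeft x (fstL (characterModule φ)) =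
      x.fst • liftCharacter φ + φ x.snd • fstL (characterModule φ) := by
    ext y; simp [mul_comm, add_comm]
  rw [bidualRight_apply, h, map_add, map_smul, map_smul]
  simp [mul_comm]

/-- Arens regularity passes from `A` to `ℂ_φ ⊕₁ A`. -/
theorem isArensRegular_characterModule (hA : IsArensRegular A) :
    IsArensRegular (ModuleExtension (characterModule φ)) := by
  intro m n
  ext g
  rw [functional_decomposition φ g]
  simp only [map_add, map_smul]
  congr 1
  · congr 1
    rw [firstArens_apply, secondArens_apply, bidualLeft_fstL, bidualRight_fstL]
    simp only [map_add, map_smul, smul_eq_mul]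
    -- Both products give `m(Φ) n(fst) + m(fst) n(Φ)`, with `Φ` here the lifted character, without
    -- using regularity of `A`.
    ring
  · rw [firstArens_apply, secondArens_apply, bidualLeft_pullback, bidualRight_pullback]
    exact DFunLike.congr_fun (hA (m.comp (pullback _)) (n.comp (pullback _))) _

end ModuleExtension

/-! ### The main theorem -/

open ModuleExtension in
theorem corollary2p2 (A : Type u) [NonUnitalNormedRing A] [NormedSpace ℂ A]
    [IsScalarTower ℂ A A] [SMulCommClass ℂ A A] [CompleteSpace A]
    (hA : IsArensRegular A) (φ : WeakDual.characterSpace ℂ A) :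
    IsDualBanachAlgebra (SecondDual.predual (ModuleExtension (characterModule φ))) ∧
      ¬ IsConnesAmenable.{u, w} (SecondDual.predual (ModuleExtension (characterModule φ))) := by
  refine ⟨(isArensRegular_characterModule φ hA).isDualBanachAlgebra,
    not_isConnesAmenable_of_pointDerivation
      (SecondDual.mem_predual (liftCharacter φ))
      (SecondDual.mem_predual (fstL (characterModule φ))) (fun m n => ?_) (fun m n => ?_) ?_⟩
  · change StrongDual ℂ (StrongDual ℂ (ModuleExtension (characterModule φ))) at m n
    change m (bidualLeft n (liftCharacter φ)) = m (liftCharacter φ) * n (liftCharacter φ)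
    rw [bidualLeft_liftCharacter, map_smul]
    exact mul_comm _ _
  · change StrongDual ℂ (StrongDual ℂ (ModuleExtension (characterModule φ))) at m n
    change m (bidualLeft n (fstL (characterModule φ))) =
      n (liftCharacter φ) * m (fstL (characterModule φ)) +
        m (liftCharacter φ) * n (fstL (characterModule φ))
    rw [bidualLeft_fstL, map_add, map_smul, map_smul, smul_eq_mul, smul_eq_mul,
      mul_comm (m (liftCharacter φ))]
  · intro h
    -- `d` takes the value `1` at the canonical image of `(1, 0)`.
    have h1 : (1 : ℂ) = 0 := DFunLike.congr_fun h
      (NormedSpace.inclusionInDoubleDual ℂ (ModuleExtension (characterModule φ)) (mk 1 0))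
    exact one_ne_zero h1
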